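/- Let $\ell<q$ be prime numbers, let $g(X)=X^q+a_{q-1}X^{q-1}+\dots+a_1X+a_0\in\mathbb{Z}[X]$, and put $f(X):=g(X^\ell)$. Assume that $f$ is irreducible and monogenic, i.e. for a root $\alpha\in\overline{\mathbb{Q}}$ of $f$, the ring $\mathbb{Z}[\alpha]$ is the full ring of integers of $\mathbb{Q}(\alpha)$. Regard $\mathrm{Gal}(f/\mathbb{Q})$ as a group of permutations of the $\ell q$ roots of $f$, and for a permutation group $H\le S_\ell$ let $H\wr C_q=H^q\rtimes C_q$ act imprimitively on $\ell q$ points ($H^q$ acts on $q$ disjoint copies of $\{1,\dots,\ell\}$, which $C_q$ permutes cyclically); $C_\ell\le S_\ell$ denotes the group generated by an $\ell$-cycle. Suppose that, up to conjugation in $S_{\ell q}$ (that is, up to relabelling the points), $\mathrm{Gal}(f/\mathbb{Q})$ is a subgroup of $S_\ell\wr C_q$, and that it does not contain any conjugate of $C_\ell\wr C_q$. Then: 1. $f$ is $p$-Eisenstein for every prime $p\mid a_0$; 2. $a_0$ is squarefree and divides each of the coefficients $a_1,\dots,a_{q-1}$; 3. every prime divisor of $a_0$ is either equal to $q$ or congruent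 to $1$ modulo $q$. -/

import Mathlib

open Polynomial IntermediateField

/-- A monic irreducible integer polynomial `f` is *monogenic* if, for a root `α` of `f` in an
algebraic closure of `ℚ`, the ring `ℤ[α]` is the full ring of integers of `ℚ(α)`.
(All roots are conjugate over `ℚ`, so the choice of the root does not matter.) -/
def IsMonogenicPoly (f : ℤ[X]) : Prop :=
  f.Monic ∧ Irreducible f ∧ ∃ α : AlgebraicClosure ℚ, aeval α f = 0 ∧
    Algebra.adjoin ℤ {AdjoinSimple.gen ℚ α} = integralClosure ℤ ℚ⟮α⟯

/-- The Galois group over `ℚ` of an integer polynomial, as a group of permutations of the set of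
roots of the polynomial in its splitting field. -/
noncomputable def galPermGroup (f : ℤ[X]) :
    Subgroup (Equiv.Perm
      ((f.map (algebraMap ℤ ℚ)).rootSet (f.map (algebraMap ℤ ℚ)).SplittingField)) :=
  (MulAction.toPermHom (f.map (algebraMap ℤ ℚ)).Gal
    ((f.map (algebraMap ℤ ℚ)).rootSet (f.map (algebraMap ℤ ℚ)).SplittingField)).range

/-- The cyclic group of order `n`, written multiplicatively. -/
abbrev Cyc (n : ℕ) : Type := Multiplicative (ZMod n)

/-- The wreath product `S_ℓ ≀ C_q = (S_ℓ)^q ⋊ C_q` in its imprimitive action on the `ℓ * q` points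
`Fin ℓ × C_q`: the base group acts on each of the `q` copies of `Fin ℓ`, and `C_q` permutes the
copies cyclically. -/
def symWreathCyc (ℓ q : ℕ) : Subgroup (Equiv.Perm (Fin ℓ × Cyc q)) :=
  (RegularWreathProduct.toPerm (Equiv.Perm (Fin ℓ)) (Cyc q) (Fin ℓ)).range

/-- The wreath product `C_ℓ ≀ C_q = (C_ℓ)^q ⋊ C_q` in its imprimitive action on the `ℓ * q` points
`C_ℓ × C_q`, where `C_ℓ` acts on itself by translations. -/
def cycWreathCyc (ℓ q : ℕ) : Subgroup (Equiv.Perm (Cyc ℓ × Cyc q)) :=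
  (RegularWreathProduct.toPerm (Cyc ℓ) (Cyc q) (Cyc ℓ)).range

/-- The permutation group `G` on `α` is a subgroup of the permutation group `H` on `β`, after a
suitable identification of `α` with `β`; that is, up to conjugation in the symmetric group. -/
def IsPermSubgroup {α β : Type*} (G : Subgroup (Equiv.Perm α)) (H : Subgroup (Equiv.Perm β)) :
    Prop :=
  ∃ e : α ≃ β, ∀ σ ∈ G, e.permCongr σ ∈ H

/-! Squarefreeness of `a_0` comes from monogenicity alone
(`squarefree_coeff_zero_of_adjoin_eq_integralClosure`): a square factor produces an integral element
outside `ℤ[α]`.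

The embedding in `S_ℓ ≀ C_q` gives a surjection `c` from the Galois group to `C_q`. As `ℓ < q`, the
blocks are the fibres of `x ↦ x ^ ℓ`, so the fixed field `K` of `c.ker` is cyclic of degree `q` over
`ℚ` and contains the roots `σ y` of `g`. Fix a prime `p ∣ a_0`.

If `p ∤ a_1`, a prime `P` of `K` above `p` contains exactly one `σ y`, with valuation `e(P)`. This
divides `q`, so it is prime to `ℓ`, and the `σ y` are independent modulo `ℓ`-th powers
(`dvd_of_prod_pow_eq_pow`). Kummer theory (`exists_gal_apply_eq_pow_mul`) and a splitting of `c`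
(`IsRootLabelling.exists_section`) then put `C_ℓ ≀ C_q` inside the Galois group, which is excluded.

Hence `p ∣ a_1`, so some `P` contains two conjugates of `y` and `p` is totally ramified in `K`
(`dvd_coeff_and_modEq_of_dvd_coeff_one`). All conjugates then lie in `P`, which gives the Eisenstein
condition. The action of the Galois group on `P / P ^ 2` and the trace of `y` give `p = q` or `p ≡
1` modulo `q`. -/

/-- Used modulo a prime containing one conjugate of `y`: the coefficient of `X` then detects whether
the prime contains a second one. -/
theorem coeff_one_prod_X_sub_C {R ι : Type*} [CommRing R] [Fintype ι] [DecidableEq ι] (b : ι → R)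
    {i : ι} (hi : b i = 0) :
    (∏ j, (X - C (b j))).coeff 1 = ∏ j ∈ Finset.univ.erase i, -b j := by
  rw [← Finset.mul_prod_erase _ _ (Finset.mem_univ i), hi, C_0, sub_zero, coeff_X_mul,
    coeff_zero_eq_eval_zero, eval_prod]
  simp

/-! ### Prime ideals in a Galois extension of degree `q` -/

section Arithmetic

open NumberField Ideal Pointwise

variable {K : Type*} [Field K] [NumberField K]
variable {g : ℤ[X]} {y : 𝓞 K}

theorem algebraMap_coeff_zero_of_eq_prod
    (hgy : g.map (algebraMap ℤ (𝓞 K)) = ∏ σ : Gal(K/ℚ), (X - C (σ • y))) :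
    algebraMap ℤ (𝓞 K) (g.coeff 0) = ∏ σ : Gal(K/ℚ), -(σ • y) := by
  rw [← coeff_map, hgy, coeff_zero_eq_eval_zero, eval_prod]
  simp

omit [NumberField K] in
theorem algebraMap_mem_iff_dvd {p : ℕ} (P : Ideal (𝓞 K)) [P.LiesOver (span {(p : ℤ)})] (a : ℤ) :
    algebraMap ℤ (𝓞 K) a ∈ P ↔ (p : ℤ) ∣ a := by
  rw [← mem_span_singleton, over_def P (span {(p : ℤ)}), under_def, mem_comap]

theorem emultiplicity_natCast_prime {p : ℕ} (hp : p.Prime) (P : Ideal (𝓞 K)) [P.IsPrime]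
    [P.LiesOver (span {(p : ℤ)})] :
    emultiplicity P (span {(p : 𝓞 K)}) = P.ramificationIdx ℤ := by
  have hb : map (algebraMap ℤ (𝓞 K)) (span {(p : ℤ)}) ≠ ⊥ := by
    simp [map_span, hp.ne_zero]
  have h := IsDedekindDomain.ramificationIdx_eq_multiplicity (S := 𝓞 K) (span {(p : ℤ)}) P hb
  have hP : P ≠ ⊥ := ne_bot_of_le_ne_bot hb (map_le_of_le_comap (P.over_def _).le)
  rw [h, ← FiniteMultiplicity.emultiplicity_eq_multiplicity]
  · simp [map_span]
  · exact FiniteMultiplicity.of_prime_left (prime_of_isPrime hP inferInstance) hb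

theorem card_primesOver_mul_ramificationIdx_mul_inertiaDeg [IsGalois ℚ K] {p : ℕ} (hp : p.Prime) (P : Ideal (𝓞 K))
    [P.IsPrime] [P.LiesOver (span {(p : ℤ)})] :
    (primesOver (span {(p : ℤ)}) (𝓞 K)).ncard * (P.ramificationIdx ℤ * P.inertiaDeg ℤ) =
      Nat.card Gal(K/ℚ) := by
  have : (span {(p : ℤ)}).IsPrime :=
    (span_singleton_prime (by exact_mod_cast hp.ne_zero)).2 (Nat.prime_iff_prime_int.1 hp)
  rw [← ncard_primesOver_mul_ramificationIdxIn_mul_inertiaDegIn (span {(p : ℤ)}) (𝓞 K) Gal(K/ℚ),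
    ramificationIdxIn_eq_ramificationIdx (span {(p : ℤ)}) P Gal(K/ℚ),
    inertiaDegIn_eq_inertiaDeg (span {(p : ℤ)}) P Gal(K/ℚ)]

theorem ne_bot_of_liesOver_prime {p : ℕ} (hp : p.Prime) (P : Ideal (𝓞 K))
    [P.LiesOver (span {(p : ℤ)})] : P ≠ ⊥ := by
  rintro rfl
  have := (algebraMap_mem_iff_dvd (p := p) (⊥ : Ideal (𝓞 K)) p).2 dvd_rfl
  simp [hp.ne_zero] at this

theorem emultiplicity_span_eq_zero_iff (P : Ideal (𝓞 K)) (x : 𝓞 K) :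
    emultiplicity P (span {x}) = 0 ↔ x ∉ P := by
  rw [emultiplicity_eq_zero, dvd_span_singleton]

theorem emultiplicity_span_prod {ι : Type*} (s : Finset ι) {P : Ideal (𝓞 K)} (hP : Prime P)
    (x : ι → 𝓞 K) : emultiplicity P (span {∏ i ∈ s, x i}) = ∑ i ∈ s, emultiplicity P (span {x i}) := by
  rw [← Finset.emultiplicity_prod hP, prod_span_singleton]

theorem emultiplicity_coeff_zero {p : ℕ} (hp : p.Prime) (P : Ideal (𝓞 K)) [P.IsPrime]
    [P.LiesOver (span {(p : ℤ)})] {a : ℤ} (h0 : (p : ℤ) ∣ a) (h00 : ¬ (p : ℤ) * p ∣ a) :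
    emultiplicity P (span {algebraMap ℤ (𝓞 K) a}) = P.ramificationIdx ℤ := by
  obtain ⟨c, rfl⟩ := h0
  have hc : ¬ (p : ℤ) ∣ c := fun h => h00 (mul_dvd_mul_left _ h)
  have hP := prime_of_isPrime (ne_bot_of_liesOver_prime hp P) (inferInstance : P.IsPrime)
  rw [map_mul, ← span_singleton_mul_span_singleton, emultiplicity_mul hP,
    (emultiplicity_span_eq_zero_iff P (algebraMap ℤ (𝓞 K) c)).2
      (by rwa [algebraMap_mem_iff_dvd (p := p)]), add_zero, ← emultiplicity_natCast_prime hp P]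
  simp

/-- Compare valuations at a prime `P` containing `σ₁ • y`: only the factor at `σ₁` contributes, so
`ℓ` divides `k σ₁ * e(P)`, while `e(P) ∣ q` is prime to `ℓ`. -/
theorem dvd_of_prod_pow_eq_pow [IsGalois ℚ K] {q ℓ p : ℕ} (hq : q.Prime) (hℓ : ℓ.Prime) (hℓq : ℓ ≠ q)
    (hcard : Nat.card Gal(K/ℚ) = q)
    (hgy : g.map (algebraMap ℤ (𝓞 K)) = ∏ σ : Gal(K/ℚ), (X - C (σ • y)))
    (hp : p.Prime) (h0 : (p : ℤ) ∣ g.coeff 0) (h00 : ¬ (p : ℤ) * p ∣ g.coeff 0)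
    (h1 : ¬ (p : ℤ) ∣ g.coeff 1) (k : Gal(K/ℚ) → ℕ) (u : 𝓞 K)
    (hu : ∏ σ : Gal(K/ℚ), (σ • y) ^ k σ = u ^ ℓ) (σ₁ : Gal(K/ℚ)) : ℓ ∣ k σ₁ := by
  classical
  have hpp : (span {(p : ℤ)}).IsPrime :=
    (span_singleton_prime (by exact_mod_cast hp.ne_zero)).2 (Nat.prime_iff_prime_int.1 hp)
  obtain ⟨⟨P₀, hP₀, hP₀p⟩⟩ := (inferInstance : Nonempty (primesOver (span {(p : ℤ)}) (𝓞 K)))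
  have hmem : ∃ τ : Gal(K/ℚ), τ • y ∈ P₀ := by
    have := (algebraMap_mem_iff_dvd P₀ _).2 h0
    rw [algebraMap_coeff_zero_of_eq_prod hgy, hP₀.prod_mem_iff] at this
    obtain ⟨τ, -, hτ⟩ := this
    exact ⟨τ, neg_mem_iff.1 hτ⟩
  obtain ⟨τ, hτ⟩ := hmem
  obtain ⟨P, hPp, hP, hPy⟩ : ∃ P : Ideal (𝓞 K), P.LiesOver (span {(p : ℤ)}) ∧ P.IsPrime ∧
      σ₁ • y ∈ P := by
    refine ⟨(σ₁ * τ⁻¹) • P₀, inferInstance, inferInstance, ?_⟩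
    have := Ideal.smul_mem_pointwise_smul (σ₁ * τ⁻¹) _ _ hτ
    simpa [smul_smul] using this
  -- A second conjugate in `P` would make the coefficient of `X` vanish modulo `P`.
  have hother : ∀ σ, σ ≠ σ₁ → σ • y ∉ P := by
    intro σ hσ hmem
    apply h1
    rw [← algebraMap_mem_iff_dvd P, ← Ideal.Quotient.eq_zero_iff_mem]
    have := congrArg (fun f => (f.map (Ideal.Quotient.mk P)).coeff 1) hgy
    simp only [Polynomial.map_prod, Polynomial.map_sub, map_X, map_C] at this
    rw [coeff_one_prod_X_sub_C (fun σ : Gal(K/ℚ) => Ideal.Quotient.mk P (σ • y)) (i := σ₁)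
      (Ideal.Quotient.eq_zero_iff_mem.2 hPy), coeff_map, coeff_map] at this
    rw [this]
    refine Finset.prod_eq_zero (i := σ) (by simp [hσ]) ?_
    rw [Ideal.Quotient.eq_zero_iff_mem.2 hmem, neg_zero]
  have hPprime := prime_of_isPrime (ne_bot_of_liesOver_prime hp P) hP
  have hv : emultiplicity P (span {σ₁ • y}) = P.ramificationIdx ℤ := by
    rw [← emultiplicity_coeff_zero hp P h0 h00, algebraMap_coeff_zero_of_eq_prod hgy,
      emultiplicity_span_prod _ hPprime, Finset.sum_eq_single σ₁]
    · rw [span_singleton_neg]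
    · intro σ _ hσ
      rw [emultiplicity_span_eq_zero_iff, neg_mem_iff]
      exact hother σ hσ
    · simp
  have hu' := congrArg (fun x => emultiplicity P (span {x})) hu
  beta_reduce at hu'
  rw [emultiplicity_span_prod _ hPprime, Finset.sum_eq_single σ₁, ← span_singleton_pow,
    ← span_singleton_pow, emultiplicity_pow hPprime, emultiplicity_pow hPprime, hv] at hu'
  · have he : ¬ ℓ ∣ P.ramificationIdx ℤ := by
      intro h
      have h2 := card_primesOver_mul_ramificationIdx_mul_inertiaDeg hp P
      rw [hcard] at h2
      exact hℓq ((Nat.prime_dvd_prime_iff_eq hℓ hq).1 (h2 ▸ ((h.mul_right _).mul_left _)))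
    refine (hℓ.dvd_mul.1 ?_).resolve_right he
    cases h : emultiplicity P (span {u}) with
    | top =>
      rw [h, ENat.mul_top (by exact_mod_cast hℓ.ne_zero)] at hu'
      exact absurd hu' (by exact_mod_cast ENat.natCast_ne_top _)
    | coe m =>
      rw [h] at hu'
      exact ⟨m, by exact_mod_cast hu'⟩
  · intro σ _ hσ
    rw [emultiplicity_span_eq_zero_iff]
    exact fun h => hother σ hσ (hP.mem_of_pow_mem _ h)
  · simp

theorem exists_natCast_sub_mem_of_inertiaDeg_eq_one {p : ℕ} (hp : p.Prime) (P : Ideal (𝓞 K))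
    [P.IsPrime] [P.LiesOver (span {(p : ℤ)})] (hf : P.inertiaDeg ℤ = 1) (d : 𝓞 K) :
    ∃ n : ℕ, d - n ∈ P := by
  have hcard : Nat.card (𝓞 K ⧸ P) = p := by
    have := pow_inertiaDeg p P
    rw [hf, pow_one] at this
    exact this.symm
  have : Finite (𝓞 K ⧸ P) := Nat.finite_of_card_ne_zero (by rw [hcard]; exact hp.ne_zero)
  have := Fintype.ofFinite (𝓞 K ⧸ P)
  have := Fact.mk hp
  let e := ZMod.ringEquivOfPrime (𝓞 K ⧸ P) hp (by rw [← Nat.card_eq_fintype_card, hcard])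
  refine ⟨(e.symm (Ideal.Quotient.mk P d)).val, ?_⟩
  rw [← Ideal.Quotient.eq, map_natCast, ← map_natCast e, ZMod.natCast_zmod_val,
    e.apply_symm_apply]

theorem eq_one_of_pow_eq_one_of_not_modEq {p q : ℕ} (hq : q.Prime) (hp : p.Prime)
    (h1 : ¬ p ≡ 1 [MOD q]) {x : ZMod p} (hx : x ^ q = 1) : x = 1 := by
  have := Fact.mk hp
  have hx0 : x ≠ 0 := by
    rintro rfl
    rw [zero_pow hq.ne_zero] at hx
    exact zero_ne_one hx
  have hco : q.Coprime (p - 1) := by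
    rw [hq.coprime_iff_not_dvd]
    intro h
    exact h1 ((Nat.modEq_iff_dvd' hp.one_lt.le).2 h).symm
  have := pow_gcd_eq_one.2 ⟨hx, ZMod.pow_card_sub_one_eq_one hx0⟩
  rwa [hco, pow_one] at this

/-- Two conjugates of `y` in `P` force `e(P) ≥ 2`, hence `e(P) = q`, and `y` is a uniformizer at
`P`. Each `ρ` multiplies `y` modulo `P ^ 2` by a `q`-th root of unity of `𝔽_p`. If 1 is the only
one, the trace of `y` is `q * y` modulo `P ^ 2`; but `p` divides the trace, so `p = q`. -/
theorem dvd_coeff_and_modEq_of_dvd_coeff_one [IsGalois ℚ K] {q p : ℕ} (hq : q.Prime)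
    (hcard : Nat.card Gal(K/ℚ) = q)
    (hgy : g.map (algebraMap ℤ (𝓞 K)) = ∏ σ : Gal(K/ℚ), (X - C (σ • y)))
    (hp : p.Prime) (h0 : (p : ℤ) ∣ g.coeff 0) (h00 : ¬ (p : ℤ) * p ∣ g.coeff 0)
    (h1 : (p : ℤ) ∣ g.coeff 1) :
    (∀ i < q, (p : ℤ) ∣ g.coeff i) ∧ (p = q ∨ p ≡ 1 [MOD q]) := by
  classical
  have hcard' : Fintype.card Gal(K/ℚ) = q := by rw [← hcard, Nat.card_eq_fintype_card]
  have hpp : (span {(p : ℤ)}).IsPrime :=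
    (span_singleton_prime (by exact_mod_cast hp.ne_zero)).2 (Nat.prime_iff_prime_int.1 hp)
  obtain ⟨⟨P, hP, hPp⟩⟩ := (inferInstance : Nonempty (primesOver (span {(p : ℤ)}) (𝓞 K)))
  have hPprime := prime_of_isPrime (ne_bot_of_liesOver_prime hp P) hP
  have hgP : g.map (algebraMap ℤ (𝓞 K ⧸ P)) =
      ∏ σ : Gal(K/ℚ), (X - C (Ideal.Quotient.mk P (σ • y))) := by
    have := congrArg (fun f => f.map (Ideal.Quotient.mk P)) hgy
    simp only [Polynomial.map_prod, Polynomial.map_sub, map_X, map_C, Polynomial.map_map] at this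
    exact this
  have hcoeff (i : ℕ) : (g.map (algebraMap ℤ (𝓞 K ⧸ P))).coeff i = 0 ↔ (p : ℤ) ∣ g.coeff i := by
    rw [coeff_map, ← algebraMap_mem_iff_dvd P, ← Ideal.Quotient.eq_zero_iff_mem]
    rfl
  obtain ⟨τ, hτ⟩ : ∃ τ : Gal(K/ℚ), τ • y ∈ P := by
    have := (algebraMap_mem_iff_dvd P _).2 h0
    rw [algebraMap_coeff_zero_of_eq_prod hgy, hP.prod_mem_iff] at this
    obtain ⟨τ, -, hτ⟩ := this
    exact ⟨τ, neg_mem_iff.1 hτ⟩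
  obtain ⟨σ, hστ, hσ⟩ : ∃ σ : Gal(K/ℚ), σ ≠ τ ∧ σ • y ∈ P := by
    have := (hcoeff 1).2 h1
    rw [hgP, coeff_one_prod_X_sub_C (fun σ : Gal(K/ℚ) => Ideal.Quotient.mk P (σ • y)) (i := τ)
      (Ideal.Quotient.eq_zero_iff_mem.2 hτ), Finset.prod_eq_zero_iff] at this
    obtain ⟨σ, hσ, h⟩ := this
    refine ⟨σ, Finset.ne_of_mem_erase hσ, ?_⟩
    rwa [neg_eq_zero, Ideal.Quotient.eq_zero_iff_mem] at h
  have hsum : ∑ σ : Gal(K/ℚ), emultiplicity P (span {σ • y}) = P.ramificationIdx ℤ := by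
    rw [← emultiplicity_coeff_zero hp P h0 h00, algebraMap_coeff_zero_of_eq_prod hgy,
      emultiplicity_span_prod _ hPprime]
    exact Finset.sum_congr rfl fun σ _ => by rw [span_singleton_neg]
  have hone {x : 𝓞 K} (hx : x ∈ P) : 1 ≤ emultiplicity P (span {x}) := by
    rw [Order.one_le_iff_ne_zero]
    exact fun h => (emultiplicity_span_eq_zero_iff P x).1 h hx
  have he2 : 2 ≤ P.ramificationIdx ℤ := by
    have : (2 : ℕ∞) ≤ P.ramificationIdx ℤ := by
      rw [← hsum]
      calc (2 : ℕ∞) = 1 + 1 := by norm_num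
        _ ≤ emultiplicity P (span {σ • y}) + emultiplicity P (span {τ • y}) :=
          add_le_add (hone hσ) (hone hτ)
        _ = ∑ ρ ∈ {σ, τ}, emultiplicity P (span {ρ • y}) := by rw [Finset.sum_pair hστ]
        _ ≤ _ := Finset.sum_le_sum_of_subset (Finset.subset_univ _)
    exact_mod_cast this
  have href := card_primesOver_mul_ramificationIdx_mul_inertiaDeg hp P
  rw [hcard] at href
  have he : P.ramificationIdx ℤ = q :=
    ((Nat.dvd_prime hq).1 (href ▸ (dvd_mul_right _ _).mul_left _)).resolve_left (by lia)
  rw [he, mul_left_comm] at href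
  have hrf := mul_eq_one.1 (Nat.eq_of_mul_eq_mul_left hq.pos (href.trans (mul_one q).symm))
  have hstab (ρ : Gal(K/ℚ)) : ρ • P = P := by
    obtain ⟨Q, hQ⟩ := Set.ncard_eq_one.1 hrf.1
    have m1 : P ∈ primesOver (span {(p : ℤ)}) (𝓞 K) := ⟨hP, hPp⟩
    have m2 : ρ • P ∈ primesOver (span {(p : ℤ)}) (𝓞 K) := ⟨inferInstance, inferInstance⟩
    rw [hQ, Set.mem_singleton_iff] at m1 m2
    rw [m2, m1]
  have hstab2 (ρ : Gal(K/ℚ)) {x : 𝓞 K} (hx : x ∈ P ^ 2) : ρ • x ∈ P ^ 2 := by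
    have := Ideal.smul_mem_pointwise_smul ρ _ _ hx
    rwa [smul_pow', hstab] at this
  have hmem (ρ : Gal(K/ℚ)) : ρ • y ∈ P := by
    have := Ideal.smul_mem_pointwise_smul (ρ * τ⁻¹) _ _ hτ
    rw [hstab] at this
    simpa [smul_smul] using this
  have hdvd : ∀ i < q, (p : ℤ) ∣ g.coeff i := by
    intro i hi
    rw [← hcoeff, hgP]
    simp_rw [Ideal.Quotient.eq_zero_iff_mem.2 (hmem _)]
    simp [hcard', coeff_X_pow, hi.ne]
  refine ⟨hdvd, or_iff_not_imp_left.2 fun hpq => ?_⟩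
  by_contra hmod
  have hmem2 (x : 𝓞 K) : x ∈ P ^ 2 ↔ 2 ≤ emultiplicity P (span {x}) := by
    rw [← dvd_span_singleton]
    exact pow_dvd_iff_le_emultiplicity (a := P) (b := span {x}) (k := 2)
  -- The `q` conjugates of `y` share the total valuation `e(P) = q`; valuation at least 2 for each
  -- would exceed it.
  have hy2 : y ∉ P ^ 2 := by
    intro hy
    have : ∑ ρ : Gal(K/ℚ), (2 : ℕ∞) ≤ P.ramificationIdx ℤ := by
      rw [← hsum]
      exact Finset.sum_le_sum fun ρ _ => (hmem2 _).1 (hstab2 ρ hy)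
    rw [he, Finset.sum_const, Finset.card_univ, hcard', nsmul_eq_mul] at this
    have : q * 2 ≤ q := by exact_mod_cast this
    have := hq.pos
    lia
  have hyP : y ∈ P := by simpa using hmem 1
  have hmul {x : 𝓞 K} (hx : x * y ∈ P ^ 2) : x ∈ P := by
    by_contra hxP
    rw [hmem2, ← span_singleton_mul_span_singleton, emultiplicity_mul hPprime,
      (emultiplicity_span_eq_zero_iff P x).2 hxP, zero_add, ← hmem2] at hx
    exact hy2 hx
  have hfix (ρ : Gal(K/ℚ)) : ρ • y - y ∈ P ^ 2 := by
    obtain ⟨d, ε, hε, hd⟩ := Ideal.exists_mul_add_mem_pow_succ (ne_bot_of_liesOver_prime hp P)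
      (i := 1) y (ρ • y) (by simpa using hyP) hy2 (by simpa using hmem ρ)
    -- The residue field is `𝔽_p`, so the multiplier can be taken to be a natural number, which `ρ`
    -- fixes; iterating `ρ` then raises it to powers.
    obtain ⟨n, hn⟩ := exists_natCast_sub_mem_of_inertiaDeg_eq_one hp P hrf.2 d
    have hρ : ρ • y - n * y ∈ P ^ 2 := by
      have : ρ • y - n * y = (d - n) * y + ε := by rw [← hd]; ring
      rw [this]
      exact add_mem (by rw [pow_two]; exact mul_mem_mul hn hyP) hε
    have hpow (i : ℕ) : ρ ^ i • y - n ^ i * y ∈ P ^ 2 := by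
      induction i with
      | zero => simp
      | succ i ih =>
        have : ρ ^ (i + 1) • y - n ^ (i + 1) * y =
            ρ • (ρ ^ i • y - n ^ i * y) + n ^ i * (ρ • y - n * y) := by
          rw [smul_sub, smul_mul', smul_pow', smul_smul, ← pow_succ']
          have : ρ • (n : 𝓞 K) = n := map_natCast (MulSemiringAction.toRingHom _ (𝓞 K) ρ) n
          rw [this]
          ring
        rw [this]
        exact add_mem (hstab2 ρ ih) (mul_mem_left _ _ hρ)
    have hq1 := hpow q
    -- Since `ρ ^ q = 1`, the multiplier satisfies `n ^ q ≡ 1` modulo `P`.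
    rw [← hcard, pow_card_eq_one', hcard, one_smul] at hq1
    have hnq : (n : 𝓞 K) ^ q - 1 ∈ P := by
      apply hmul
      rw [← neg_mem_iff]
      convert hq1 using 1
      ring
    have hn1 : ((n : ℤ) : ZMod p) = 1 := by
      apply eq_one_of_pow_eq_one_of_not_modEq hq hp hmod
      have : (p : ℤ) ∣ (n : ℤ) ^ q - 1 := by
        rw [← algebraMap_mem_iff_dvd P]
        simpa using hnq
      rw [← ZMod.intCast_zmod_eq_zero_iff_dvd] at this
      push_cast at this ⊢
      exact sub_eq_zero.1 this
    have hn1' : (n : 𝓞 K) - 1 ∈ P := by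
      have : (p : ℤ) ∣ (n : ℤ) - 1 := by
        rw [← ZMod.intCast_zmod_eq_zero_iff_dvd, Int.cast_sub, hn1, Int.cast_one, sub_self]
      rw [← algebraMap_mem_iff_dvd P] at this
      simpa using this
    have : ρ • y - y = (ρ • y - n * y) + (n - 1) * y := by ring
    rw [this]
    exact add_mem hρ (by rw [pow_two]; exact mul_mem_mul hn1' hyP)
  have hp2 : (p : 𝓞 K) ∈ P ^ 2 := by
    rw [hmem2, emultiplicity_natCast_prime hp]
    exact_mod_cast he2
  have htr : ∑ ρ : Gal(K/ℚ), ρ • y ∈ P ^ 2 := by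
    have h := prod_X_sub_C_coeff_card_pred Finset.univ (fun ρ : Gal(K/ℚ) => ρ • y)
      (by rw [Finset.card_univ, hcard']; exact hq.pos)
    rw [← hgy, Finset.card_univ, hcard', coeff_map] at h
    obtain ⟨c, hc⟩ := hdvd (q - 1) (by have := hq.pos; lia)
    rw [← neg_mem_iff, ← h, hc, map_mul]
    exact mul_mem_right _ _ (by simpa using hp2)
  have hqy : (q : 𝓞 K) * y ∈ P ^ 2 := by
    have h : ∑ ρ : Gal(K/ℚ), (ρ • y - y) ∈ P ^ 2 := Ideal.sum_mem _ fun ρ _ => hfix ρ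
    rw [Finset.sum_sub_distrib, Finset.sum_const, Finset.card_univ, hcard', nsmul_eq_mul] at h
    rw [← sub_sub_cancel (∑ ρ : Gal(K/ℚ), ρ • y) ((q : 𝓞 K) * y)]
    exact sub_mem htr h
  have hqP := hmul hqy
  have : (p : ℤ) ∣ (q : ℤ) := by
    rw [← algebraMap_mem_iff_dvd P]
    simpa using hqP
  exact hpq ((Nat.prime_dvd_prime_iff_eq hp hq).1 (by exact_mod_cast this))

end Arithmetic

/-! ### Squarefreeness of the constant coefficient -/

section Squarefree

/-- Write `f = X ^ ℓ * h + a_0`. If `a_0 = d * d * b`, then `β = a ^ (ℓ - 1) * h(a) / d` is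
integral, as `β ^ 2 = -b * a ^ (ℓ - 2) * h(a)`. It is not in `ℤ[a]` unless `d` is a unit, because `X
^ (ℓ - 1) * h` is monic of degree below that of `f`. -/
theorem squarefree_coeff_zero_of_adjoin_eq_integralClosure {K : Type*} [Field K] [CharZero K]
    {ℓ : ℕ} (hℓ : 2 ≤ ℓ) {g : ℤ[X]} (hmonic : (g.comp (X ^ ℓ)).Monic)
    (hirr : Irreducible (g.comp (X ^ ℓ))) {a : K} (haf : aeval a (g.comp (X ^ ℓ)) = 0)
    (hadj : Algebra.adjoin ℤ {a} = integralClosure ℤ K) : Squarefree (g.coeff 0) := by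
  rintro d ⟨b, hb⟩
  by_contra hd
  obtain ⟨n, rfl⟩ : ∃ n, ℓ = n + 2 := ⟨ℓ - 2, by lia⟩
  set f := g.comp (X ^ (n + 2)) with hfdef
  set h : ℤ[X] := g.divX.comp (X ^ (n + 2)) with hh
  have hfh : f = X ^ (n + 2) * h + C (g.coeff 0) := by
    rw [hfdef, hh]
    conv_lhs => rw [← divX_mul_X_add g]
    simp [mul_comm]
  have haint : IsIntegral ℤ a := ⟨f, hmonic, by rwa [← aeval_def]⟩
  have hd0 : (d : K) ≠ 0 := by
    rintro h0
    have : d = 0 := by exact_mod_cast h0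
    subst this
    rw [hb] at hfh
    simp only [zero_mul, C_0, add_zero] at hfh
    rw [hfh, pow_succ', mul_assoc] at hirr
    rcases hirr.isUnit_or_isUnit rfl with h3 | h3
    · exact not_isUnit_X h3
    · exact not_isUnit_X (isUnit_of_dvd_unit ((dvd_pow_self X n.succ_ne_zero).mul_right h) h3)
  have hrel : a ^ (n + 2) * aeval a h = -(d * d * b : ℤ) := by
    have := haf
    rw [hfh, hb] at this
    simp only [map_add, map_mul, map_pow, aeval_X, eq_intCast, map_intCast] at this
    push_cast
    linear_combination this
  have hβ : IsIntegral ℤ (a ^ (n + 1) * aeval a h / d) := by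
    apply IsIntegral.of_pow two_pos
    have : (a ^ (n + 1) * aeval a h / d) ^ 2 = -(b : K) * (a ^ n * aeval a h) := by
      rw [div_pow, div_eq_iff (pow_ne_zero _ hd0)]
      push_cast at hrel
      linear_combination (a ^ n * aeval a h) * hrel
    rw [this]
    have hb' : IsIntegral ℤ (b : K) := isIntegral_algebraMap (R := ℤ) (x := b)
    have hh' : IsIntegral ℤ (aeval a h) := by
      have := aeval_mem_adjoin_singleton ℤ a (p := h)
      rwa [hadj] at this
    exact hb'.neg.mul ((haint.pow n).mul hh')
  have hmem : a ^ (n + 1) * aeval a h / d ∈ Algebra.adjoin ℤ {a} := by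
    rw [hadj]; exact hβ
  rw [Algebra.adjoin_singleton_eq_range_aeval] at hmem
  obtain ⟨r, hr⟩ := hmem
  have hr' : aeval a (C d * r - X ^ (n + 1) * h) = 0 := by
    have hr2 : aeval a r = a ^ (n + 1) * aeval a h / d := hr
    simp only [map_sub, map_mul, map_pow, aeval_X, eq_intCast, map_intCast, hr2]
    field_simp
    ring
  have hmin : f = minpoly ℤ a := by
    have hdvd := minpoly.isIntegrallyClosed_dvd haint haf
    exact (eq_of_monic_of_associated (minpoly.monic haint) hmonic
      ((minpoly.irreducible haint).associated_of_dvd hirr hdvd)).symm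
  have hdvd : f ∣ C d * r - X ^ (n + 1) * h := hmin ▸ minpoly.isIntegrallyClosed_dvd haint hr'
  have hpos : 0 < f.natDegree := by
    rw [hmin]; exact minpoly.natDegree_pos haint
  have hXw : X * (X ^ (n + 1) * h) = f - C (g.coeff 0) := by rw [hfh]; ring
  have hdeg : (C (g.coeff 0)).degree < f.degree := by
    refine degree_C_le.trans_lt ?_
    rwa [← natDegree_pos_iff_degree_pos]
  have hwm : (X ^ (n + 1) * h).Monic := by
    refine monic_X.of_mul_monic_left ?_
    rw [hXw]
    exact hmonic.sub_of_left hdeg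
  have hwdeg : (X ^ (n + 1) * h).natDegree < f.natDegree := by
    have := natDegree_X_mul hwm.ne_zero
    rw [hXw, natDegree_sub_C] at this
    lia
  -- Modulo `d`, the monic `f` would divide a monic polynomial of smaller degree.
  let S := ℤ ⧸ Ideal.span {d}
  have : Nontrivial S := Ideal.Quotient.nontrivial_iff.2 (by rwa [Ne, Ideal.span_singleton_eq_top])
  have hdS := map_dvd (mapRingHom (Ideal.Quotient.mk (Ideal.span {d}))) hdvd
  simp only [map_sub, map_mul (mapRingHom _) (C d) r, coe_mapRingHom, map_C,
    Ideal.Quotient.eq_zero_iff_mem.2 (Ideal.mem_span_singleton_self d), C_0, zero_mul, zero_sub,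
    dvd_neg] at hdS
  refine (hmonic.map _).not_dvd_of_natDegree_lt (hwm.map _).ne_zero ?_ hdS
  rwa [hwm.natDegree_map, hmonic.natDegree_map]

theorem squarefree_coeff_zero_of_isMonogenicPoly {ℓ : ℕ} (hℓ : 2 ≤ ℓ) {g : ℤ[X]}
    (hf : IsMonogenicPoly (g.comp (X ^ ℓ))) : Squarefree (g.coeff 0) := by
  obtain ⟨hmonic, hirr, α, hα, hadj⟩ := hf
  refine squarefree_coeff_zero_of_adjoin_eq_integralClosure hℓ hmonic hirr ?_ hadj
  apply (algebraMap ℚ⟮α⟯ (AlgebraicClosure ℚ)).injective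
  rw [← aeval_algebraMap_apply, map_zero, AdjoinSimple.algebraMap_gen, hα]

end Squarefree

/-! ### Descent of `ℓ`-th powers, and passage to rings of integers -/

/-- The fixing condition puts `z` in `K(ζ)`. Were `w` not an `ℓ`-th power in `K`, `X ^ ℓ - w` would
be irreducible and `ℓ` would divide `[K(ζ) : K] ≤ ℓ - 1`. -/
theorem exists_pow_eq_of_fixed {K M : Type*} [Field K] [Field M] [CharZero M] [Algebra K M]
    [FiniteDimensional K M] [IsGalois K M] {ℓ : ℕ} (hℓ : ℓ.Prime) {ζ : M} (hζ : IsPrimitiveRoot ζ ℓ)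
    {z : M} {w : K} (hz : z ^ ℓ = algebraMap K M w)
    (hfix : ∀ τ : Gal(M/K), τ ζ = ζ → τ z = z) : ∃ u : K, u ^ ℓ = w := by
  by_contra! hu
  have hirr := X_pow_sub_C_irreducible_of_prime hℓ hu
  have hzL : z ∈ K⟮ζ⟯ := by
    rw [← IsGalois.fixedField_fixingSubgroup K⟮ζ⟯]
    rintro ⟨τ, hτ⟩
    exact hfix τ (hτ ⟨ζ, mem_adjoin_simple_self K ζ⟩)
  have hmin : minpoly K z = X ^ ℓ - C w :=
    (minpoly.eq_of_irreducible_of_monic hirr (by simp [hz]) (monic_X_pow_sub_C w hℓ.ne_zero)).symm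
  have hζint : IsIntegral K ζ := Algebra.IsIntegral.isIntegral ζ
  have h1 : (minpoly K z).natDegree ∣ Module.finrank K K⟮ζ⟯ := by
    have := minpoly.degree_dvd (Algebra.IsIntegral.isIntegral (R := K) (⟨z, hzL⟩ : K⟮ζ⟯))
    rwa [← minpoly.algebraMap_eq (algebraMap K⟮ζ⟯ M).injective] at this
  rw [hmin, natDegree_X_pow_sub_C, adjoin.finrank hζint] at h1
  have h2 : (minpoly K ζ).natDegree ≤ ℓ - 1 := by
    rw [← Nat.totient_prime hℓ, ← natDegree_cyclotomic ℓ K]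
    refine natDegree_le_of_dvd (minpoly.dvd _ _ ?_) (cyclotomic_ne_zero ℓ K)
    have : NeZero (ℓ : M) := ⟨by exact_mod_cast hℓ.ne_zero⟩
    rw [aeval_def, eval₂_eq_eval_map, map_cyclotomic]
    exact (isRoot_cyclotomic_iff.2 hζ)
  have h3 := Nat.le_of_dvd (minpoly.natDegree_pos hζint) h1
  have := hℓ.pos
  lia

open NumberField in
theorem map_eq_prod_X_sub_C_of_injective {K : Type*} [Field K] [NumberField K] {q : ℕ}
    (hcard : Nat.card Gal(K/ℚ) = q) {g : ℤ[X]} (hg : g.Monic) (hdeg : g.natDegree = q) {y : 𝓞 K}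
    (hy : aeval y g = 0) (hinj : Function.Injective fun σ : Gal(K/ℚ) => σ • y) :
    g.map (algebraMap ℤ (𝓞 K)) = ∏ σ : Gal(K/ℚ), (X - C (σ • y)) := by
  have hm : (∏ σ : Gal(K/ℚ), (X - C (σ • y))).Monic := monic_prod_of_monic _ _ fun σ _ => monic_X_sub_C _
  refine eq_of_monic_of_dvd_of_natDegree_le hm (hg.map _) ?_ ?_
  · have hms := Multiset.map_map (fun a : 𝓞 K => X - C a) (fun σ : Gal(K/ℚ) => σ • y)
      Finset.univ.val
    rw [Finset.prod_eq_multiset_prod]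
    erw [← hms]
    rw [Multiset.prod_X_sub_C_dvd_iff_le_roots (hg.map _).ne_zero,
      Multiset.le_iff_subset (Finset.univ.nodup.map hinj)]
    intro x hx
    obtain ⟨σ, -, rfl⟩ := Multiset.mem_map.1 hx
    rw [mem_roots (hg.map _).ne_zero, IsRoot.def, eval_map_algebraMap]
    have := aeval_algHom_apply (MulSemiringAction.toAlgHom ℤ (𝓞 K) σ) y g
    rw [hy, map_zero] at this
    exact this
  · rw [hg.natDegree_map, hdeg, natDegree_prod_of_monic _ _ fun σ _ => monic_X_sub_C _]
    simp [← hcard]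

open NumberField in
theorem exists_ringOfIntegers_map_eq_prod {K : Type*} [Field K] [NumberField K] {q : ℕ}
    (hcard : Nat.card Gal(K/ℚ) = q) {g : ℤ[X]} (hg : g.Monic) (hdeg : g.natDegree = q) {y : K}
    (hy : aeval y g = 0) (hinj : Function.Injective fun σ : Gal(K/ℚ) => σ y) :
    ∃ y' : 𝓞 K, (y' : K) = y ∧
      g.map (algebraMap ℤ (𝓞 K)) = ∏ σ : Gal(K/ℚ), (X - C (σ • y')) := by
  obtain ⟨y', rfl⟩ : ∃ y' : 𝓞 K, (y' : K) = y := ⟨⟨y, g, hg, by rwa [← aeval_def]⟩, rfl⟩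
  refine ⟨y', rfl, map_eq_prod_X_sub_C_of_injective hcard hg hdeg ?_ ?_⟩
  · apply RingOfIntegers.coe_injective
    rw [map_zero, ← aeval_algebraMap_apply]
    exact hy
  · intro σ τ h
    exact hinj (congrArg (fun x : 𝓞 K => (x : K)) h)

section Rational

variable {K : Type*} [Field K] [CharZero K] [inst : Algebra ℚ K] [FiniteDimensional ℚ K]
  [IsGalois ℚ K]

open NumberField in
theorem dvd_of_prod_galois_pow_eq_pow {q ℓ p : ℕ} (hq : q.Prime) (hℓ : ℓ.Prime) (hℓq : ℓ ≠ q)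
    (hcard : Nat.card Gal(K/ℚ) = q) {g : ℤ[X]} (hg : g.Monic) (hdeg : g.natDegree = q) {y : K}
    (hy : aeval y g = 0) (hinj : Function.Injective fun σ : Gal(K/ℚ) => σ y)
    (hp : p.Prime) (h0 : (p : ℤ) ∣ g.coeff 0) (h00 : ¬ (p : ℤ) * p ∣ g.coeff 0)
    (h1 : ¬ (p : ℤ) ∣ g.coeff 1) (k : Gal(K/ℚ) → ℕ) (u : K)
    (hu : ∏ σ : Gal(K/ℚ), σ y ^ k σ = u ^ ℓ) (σ₁ : Gal(K/ℚ)) : ℓ ∣ k σ₁ := by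
  -- The `ℚ`-algebra structure is arbitrary so that the result applies to an intermediate field with
  -- its own structure; all such structures coincide.
  have hinst : inst = DivisionRing.toRatAlgebra := Subsingleton.elim _ _
  subst hinst
  have : NumberField K := { to_charZero := inferInstance, to_finiteDimensional := inferInstance }
  obtain ⟨y', rfl, hgy⟩ := exists_ringOfIntegers_map_eq_prod hcard hg hdeg hy hinj
  have hu' : ((∏ σ : Gal(K/ℚ), (σ • y') ^ k σ : 𝓞 K) : K) = u ^ ℓ := by
    rw [← hu]
    exact map_prod (algebraMap (𝓞 K) K) _ _
  have huint : IsIntegral ℤ u := by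
    apply IsIntegral.of_pow hℓ.pos
    rw [← hu']
    exact RingOfIntegers.isIntegral_coe _
  exact dvd_of_prod_pow_eq_pow hq hℓ hℓq hcard hgy hp h0 h00 h1 k ⟨u, huint⟩
    (RingOfIntegers.ext hu') σ₁

theorem dvd_coeff_and_modEq_of_isGalois {q p : ℕ} (hq : q.Prime)
    (hcard : Nat.card Gal(K/ℚ) = q) {g : ℤ[X]} (hg : g.Monic) (hdeg : g.natDegree = q) {y : K}
    (hy : aeval y g = 0) (hinj : Function.Injective fun σ : Gal(K/ℚ) => σ y)
    (hp : p.Prime) (h0 : (p : ℤ) ∣ g.coeff 0) (h00 : ¬ (p : ℤ) * p ∣ g.coeff 0)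
    (h1 : (p : ℤ) ∣ g.coeff 1) :
    (∀ i < q, (p : ℤ) ∣ g.coeff i) ∧ (p = q ∨ p ≡ 1 [MOD q]) := by
  have hinst : inst = DivisionRing.toRatAlgebra := Subsingleton.elim _ _
  subst hinst
  have : NumberField K := { to_charZero := inferInstance, to_finiteDimensional := inferInstance }
  obtain ⟨y', -, hgy⟩ := exists_ringOfIntegers_map_eq_prod hcard hg hdeg hy hinj
  exact dvd_coeff_and_modEq_of_dvd_coeff_one hq hcard hgy hp h0 h00 h1

end Rational

/-! ### Labelled roots and the cyclic subfield of degree `q` -/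

theorem pow_zmod_val_add {G : Type*} [Monoid G] {n : ℕ} [NeZero n] {x : G} (hx : x ^ n = 1)
    (a b : ZMod n) : x ^ (a + b).val = x ^ a.val * x ^ b.val := by
  rw [ZMod.val_add, ← pow_eq_pow_mod _ hx, pow_add]

/-- An equivariant labelling of the roots of `g(X ^ ℓ)` by the elements of `C_q`. -/
structure IsRootLabelling {F M : Type*} [Field F] [Field M] [Algebra F M] (ℓ q : ℕ) (g : ℤ[X])
    (c : Gal(M/F) →* Cyc q) (N : M → Cyc q) : Prop where
  exists_apply_eq : ∀ x x' : M, aeval (x ^ ℓ) g = 0 → aeval (x' ^ ℓ) g = 0 →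
    ∃ σ : Gal(M/F), σ x = x'
  label_apply : ∀ (σ : Gal(M/F)) (x : M), aeval (x ^ ℓ) g = 0 → N (σ x) = c σ * N x
  exists_label_eq : ∀ j, ∃ x : M, aeval (x ^ ℓ) g = 0 ∧ N x = j

section

variable {F M : Type*} [Field F] [Field M] [Algebra F M]

/-- Pigeonhole: `ℓ + 1` iterates of `x` lie among at most `ℓ` roots of `X ^ ℓ - x ^ ℓ`. -/
theorem exists_pow_apply_eq_self {ℓ : ℕ} (hℓ : 0 < ℓ) (σ : Gal(M/F)) {x : M}
    (hx : σ (x ^ ℓ) = x ^ ℓ) : ∃ d, 0 < d ∧ d ≤ ℓ ∧ (σ ^ d) x = x := by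
  classical
  have hpow (i : ℕ) : (σ ^ i) (x ^ ℓ) = x ^ ℓ := by
    induction i with
    | zero => simp
    | succ i ih => rw [pow_succ, AlgEquiv.mul_apply, hx, ih]
  obtain ⟨i, hi, j, hj, hij, h⟩ := Finset.exists_ne_map_eq_of_card_lt_of_maps_to
    (s := Finset.range (ℓ + 1)) (t := (nthRoots ℓ (x ^ ℓ)).toFinset) (f := fun i => (σ ^ i) x)
    (by
      rw [Finset.card_range, Nat.lt_succ_iff]
      exact (Multiset.toFinset_card_le _).trans (card_nthRoots _ _))
    (by
      intro i _
      simp only [Finset.mem_coe, Multiset.mem_toFinset, mem_nthRoots hℓ]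
      rw [← map_pow, hpow])
  wlog hlt : i < j generalizing i j
  · exact this j hj i hi hij.symm h.symm (by lia)
  refine ⟨j - i, by lia, by simp at hj; lia, ?_⟩
  apply (σ ^ i).injective
  rw [← AlgEquiv.mul_apply, ← pow_add, Nat.add_sub_cancel' hlt.le]
  exact h.symm

theorem pow_factorial_apply_eq_self {ℓ : ℕ} (hℓ : 0 < ℓ) (σ : Gal(M/F)) {x : M}
    (hx : σ (x ^ ℓ) = x ^ ℓ) : (σ ^ ℓ.factorial) x = x := by
  obtain ⟨d, hd, hdℓ, h⟩ := exists_pow_apply_eq_self hℓ σ hx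
  obtain ⟨e, he⟩ := Nat.dvd_factorial hd hdℓ
  have hpow (i : ℕ) : ((σ ^ d) ^ i) x = x := by
    induction i with
    | zero => simp
    | succ i ih => rw [pow_succ, AlgEquiv.mul_apply, h, ih]
  rw [he, pow_mul, hpow]

theorem aeval_apply_pow_eq_zero {ℓ : ℕ} {g : ℤ[X]} (σ : Gal(M/F)) {x : M}
    (hx : aeval (x ^ ℓ) g = 0) : aeval ((σ x) ^ ℓ) g = 0 := by
  have := aeval_algHom_apply (σ.toAlgHom.restrictScalars ℤ) (x ^ ℓ) g
  rw [hx, map_zero] at this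
  simpa using this

theorem Cyc.eq_one_of_pow_eq_one {q : ℕ} (hq : q.Prime) {t : Cyc q} {d : ℕ} (hd : ¬ q ∣ d)
    (h : t ^ d = 1) : t = 1 := by
  have hco : q.Coprime d := (hq.coprime_iff_not_dvd).2 hd
  have h2 : t ^ q = 1 := by
    apply Multiplicative.toAdd.injective
    simp
  have := pow_gcd_eq_one.2 ⟨h2, h⟩
  rwa [hco, pow_one] at this

namespace IsRootLabelling

variable {ℓ q : ℕ} {g : ℤ[X]} {c : Gal(M/F) →* Cyc q} {N : M → Cyc q}

/-- Some `σ ^ d` with `0 < d ≤ ℓ < q` fixes `x`, hence its label, so `c σ ^ d = 1` with `d` prime to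
`q`. -/
theorem map_eq_one (H : IsRootLabelling ℓ q g c N) (hq : q.Prime) (hℓ : 0 < ℓ) (hℓq : ℓ < q)
    {σ : Gal(M/F)} {x : M} (hx : aeval (x ^ ℓ) g = 0) (hσ : σ (x ^ ℓ) = x ^ ℓ) : c σ = 1 := by
  obtain ⟨d, hd, hdℓ, h⟩ := exists_pow_apply_eq_self hℓ σ hσ
  refine Cyc.eq_one_of_pow_eq_one hq (d := d) (fun hqd => ?_) ?_
  · have := Nat.le_of_dvd hd hqd
    lia
  · have := H.label_apply (σ ^ d) x hx
    rw [h, eq_comm, mul_eq_right] at this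
    rwa [← map_pow]

theorem map_eq_of_apply_eq (H : IsRootLabelling ℓ q g c N) (hq : q.Prime) (hℓ : 0 < ℓ)
    (hℓq : ℓ < q) {σ τ : Gal(M/F)} {x : M} (hx : aeval (x ^ ℓ) g = 0)
    (hστ : σ (x ^ ℓ) = τ (x ^ ℓ)) : c σ = c τ := by
  rw [← inv_mul_eq_one, ← map_inv, ← map_mul]
  refine H.map_eq_one hq hℓ hℓq hx ?_
  rw [AlgEquiv.mul_apply, ← hστ, ← AlgEquiv.mul_apply, inv_mul_cancel, AlgEquiv.one_apply]

/-- Equal powers give equal labels by transitivity and `map_eq_one`. Conversely, one root per label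
gives `q` distinct powers, which exhaust the roots of `g`. -/
theorem pow_eq_pow_iff (H : IsRootLabelling ℓ q g c N) (hq : q.Prime) (hℓ : 0 < ℓ) (hℓq : ℓ < q)
    (hg : g.Monic) (hdeg : g.natDegree = q) {x x' : M} (hx : aeval (x ^ ℓ) g = 0)
    (hx' : aeval (x' ^ ℓ) g = 0) : x ^ ℓ = x' ^ ℓ ↔ N x = N x' := by
  classical
  have : NeZero q := ⟨hq.ne_zero⟩
  have key {x x' : M} (hx : aeval (x ^ ℓ) g = 0) (hx' : aeval (x' ^ ℓ) g = 0)
      (h : x ^ ℓ = x' ^ ℓ) : N x = N x' := by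
    obtain ⟨σ, rfl⟩ := H.exists_apply_eq x x' hx hx'
    rw [H.label_apply σ x hx, H.map_eq_one hq hℓ hℓq hx (by rw [map_pow, ← h]), one_mul]
  refine ⟨key hx hx', fun h => ?_⟩
  choose r hr hNr using H.exists_label_eq
  have hY : Finset.univ.image (fun j => r j ^ ℓ) = (g.aroots M).toFinset := by
    apply Finset.eq_of_subset_of_card_le
    · intro y hy
      obtain ⟨j, -, rfl⟩ := Finset.mem_image.1 hy
      rw [Multiset.mem_toFinset, mem_aroots']
      exact ⟨(hg.map _).ne_zero, hr j⟩
    · rw [Finset.card_image_of_injective, Finset.card_univ]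
      · refine (Multiset.toFinset_card_le _).trans ((card_roots' _).trans ?_)
        rw [hg.natDegree_map, hdeg, ← Nat.card_eq_fintype_card]
        simp
      · intro i j hij
        rw [← hNr i, ← hNr j]
        exact key (hr i) (hr j) hij
  have hpow {x : M} (hx : aeval (x ^ ℓ) g = 0) : x ^ ℓ = r (N x) ^ ℓ := by
    have : x ^ ℓ ∈ (g.aroots M).toFinset := by
      rw [Multiset.mem_toFinset, mem_aroots']
      exact ⟨(hg.map _).ne_zero, hx⟩
    rw [← hY] at this
    obtain ⟨j, -, hj⟩ := Finset.mem_image.1 this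
    have h2 := key (hr j) hx hj
    rw [hNr] at h2
    rw [← h2, hj]
  rw [hpow hx, hpow hx', h]

theorem apply_pow_eq (H : IsRootLabelling ℓ q g c N) (hq : q.Prime) (hℓ : 0 < ℓ) (hℓq : ℓ < q)
    (hg : g.Monic) (hdeg : g.natDegree = q) {σ : Gal(M/F)} (hσ : c σ = 1) {x : M}
    (hx : aeval (x ^ ℓ) g = 0) : σ (x ^ ℓ) = x ^ ℓ := by
  rw [map_pow, H.pow_eq_pow_iff hq hℓ hℓq hg hdeg (aeval_apply_pow_eq_zero σ hx) hx,
    H.label_apply σ x hx, hσ, one_mul]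

theorem surjective (H : IsRootLabelling ℓ q g c N) : Function.Surjective c := by
  intro j
  obtain ⟨x, hx, h1⟩ := H.exists_label_eq 1
  obtain ⟨x', hx', hj⟩ := H.exists_label_eq j
  obtain ⟨σ, rfl⟩ := H.exists_apply_eq x x' hx hx'
  exact ⟨σ, by rw [← hj, H.label_apply σ x hx, h1, mul_one]⟩

theorem card_gal_fixedField_ker [FiniteDimensional F M] [IsGalois F M]
    (H : IsRootLabelling ℓ q g c N) : Nat.card Gal(fixedField c.ker/F) = q := by
  rw [← Nat.card_congr (IsGalois.normalAutEquivQuotient c.ker).toEquiv,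
    Nat.card_congr (QuotientGroup.quotientKerEquivOfSurjective c H.surjective).toEquiv]
  exact (Nat.card_congr Multiplicative.toAdd).trans (Nat.card_zmod q)

theorem pow_mem_fixedField (H : IsRootLabelling ℓ q g c N) (hq : q.Prime) (hℓ : 0 < ℓ)
    (hℓq : ℓ < q) (hg : g.Monic) (hdeg : g.natDegree = q) {x : M} (hx : aeval (x ^ ℓ) g = 0) :
    x ^ ℓ ∈ fixedField c.ker := by
  rintro ⟨σ, hσ⟩
  exact H.apply_pow_eq hq hℓ hℓq hg hdeg hσ hx

/-- The value of `c` is determined by the action on `x ^ ℓ`, and automorphisms with the same value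
agree on the fixed field. -/
theorem injective_gal_fixedField [FiniteDimensional F M] [IsGalois F M]
    (H : IsRootLabelling ℓ q g c N) (hq : q.Prime) (hℓ : 0 < ℓ) (hℓq : ℓ < q) {x : M}
    (hx : aeval (x ^ ℓ) g = 0) {y : fixedField c.ker} (hy : (y : M) = x ^ ℓ) :
    Function.Injective fun σ : Gal(fixedField c.ker/F) => σ y := by
  have := IsGalois.of_fixedField_normal_subgroup c.ker
  intro ρ ρ' h
  obtain ⟨σ, rfl⟩ := AlgEquiv.restrictNormalHom_surjective (F := F) (K₁ := fixedField c.ker) M ρ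
  obtain ⟨τ, rfl⟩ := AlgEquiv.restrictNormalHom_surjective (F := F) (K₁ := fixedField c.ker) M ρ'
  have hcom (σ : Gal(M/F)) (z : fixedField c.ker) :
      ((AlgEquiv.restrictNormalHom (fixedField c.ker) σ z : fixedField c.ker) : M) = σ z :=
    σ.restrictNormal_commutes (fixedField c.ker) z
  have hc : c σ = c τ := by
    apply H.map_eq_of_apply_eq hq hℓ hℓq hx
    rw [← hy, ← hcom, ← hcom]
    exact congrArg _ h
  ext z
  rw [hcom, hcom]
  have hmem : τ⁻¹ * σ ∈ c.ker := by rw [MonoidHom.mem_ker, map_mul, hc, map_inv, inv_mul_cancel]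
  have := z.2 ⟨_, hmem⟩
  have h2 : (τ⁻¹ * σ) (z : M) = z := this
  conv_rhs => rw [← h2, ← AlgEquiv.mul_apply, mul_inv_cancel_left]

end IsRootLabelling

end

/-! ### Kummer theory and the wreath product `C_ℓ ≀ C_q` -/

/-- The attainable exponent vectors form a subspace `V` of `𝔽_ℓ ^ I`. A nonzero linear form killing
`V` would have as coefficients the exponents of a monomial in the `x i` fixed by every relevant `τ`,
and `hrel` makes these exponents vanish modulo `ℓ`. -/
theorem exists_gal_apply_eq_pow_mul {F M I : Type*} [Field F] [Field M] [Algebra F M] [Finite I]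
    {ℓ : ℕ} (hℓ : ℓ.Prime) {ζ : M} (hζ : IsPrimitiveRoot ζ ℓ) {x : I → M} (hx : ∀ i, x i ≠ 0)
    (hrel : ∀ k : I → ℕ, (∀ τ : Gal(M/F), (∀ i, τ (x i ^ ℓ) = x i ^ ℓ) → τ ζ = ζ →
      τ (∏ᶠ i, x i ^ k i) = ∏ᶠ i, x i ^ k i) → ∀ i, ℓ ∣ k i) (v : I → ZMod ℓ) :
    ∃ τ : Gal(M/F), τ ζ = ζ ∧ ∀ i, τ (x i) = ζ ^ (v i).val * x i := by
  classical
  have := Fintype.ofFinite I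
  have : NeZero ℓ := ⟨hℓ.ne_zero⟩
  have : Fact ℓ.Prime := ⟨hℓ⟩
  have hadd {v w : I → ZMod ℓ} : (∃ τ : Gal(M/F), τ ζ = ζ ∧ ∀ i, τ (x i) = ζ ^ (v i).val * x i) →
      (∃ τ : Gal(M/F), τ ζ = ζ ∧ ∀ i, τ (x i) = ζ ^ (w i).val * x i) →
      ∃ τ : Gal(M/F), τ ζ = ζ ∧ ∀ i, τ (x i) = ζ ^ ((v + w) i).val * x i := by
    rintro ⟨σ, hσ, hσ'⟩ ⟨τ, hτ, hτ'⟩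
    refine ⟨σ * τ, by rw [AlgEquiv.mul_apply, hτ, hσ], fun i => ?_⟩
    rw [AlgEquiv.mul_apply, hτ', map_mul, map_pow, hσ, hσ', Pi.add_apply,
      pow_zmod_val_add hζ.pow_eq_one]
    ring
  have hzero : ∃ τ : Gal(M/F), τ ζ = ζ ∧ ∀ i, τ (x i) = ζ ^ ((0 : I → ZMod ℓ) i).val * x i :=
    ⟨1, rfl, fun i => by simp⟩
  let V : Submodule (ZMod ℓ) (I → ZMod ℓ) :=
    { carrier := {v | ∃ τ : Gal(M/F), τ ζ = ζ ∧ ∀ i, τ (x i) = ζ ^ (v i).val * x i}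
      add_mem' := hadd
      zero_mem' := hzero
      smul_mem' := by
        intro a v hv
        have hn (n : ℕ) : ∃ τ : Gal(M/F), τ ζ = ζ ∧ ∀ i, τ (x i) = ζ ^ ((n • v) i).val * x i := by
          induction n with
          | zero => simpa using hzero
          | succ n ih => rw [succ_nsmul]; exact hadd ih hv
        have : a • v = a.val • v := by
          rw [← Nat.cast_smul_eq_nsmul (ZMod ℓ), ZMod.natCast_zmod_val]
        rw [this]
        exact hn _ }
  suffices hV : V = ⊤ by
    have : v ∈ V := hV ▸ Submodule.mem_top
    exact this
  by_contra hV
  obtain ⟨f, hf, hVf⟩ := Submodule.exists_le_ker_of_lt_top V (lt_top_iff_ne_top.2 hV)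
  apply hf
  let e (i : I) : ZMod ℓ := f (Pi.single i 1)
  have hfe (w : I → ZMod ℓ) : f w = ∑ i, w i * e i := by
    rw [LinearMap.pi_apply_eq_sum_univ f w]
    refine Finset.sum_congr rfl fun i _ => ?_
    rw [smul_eq_mul]
    congr 2
    ext j
    simp [Pi.single_apply, eq_comm]
  have he := hrel (fun i => (e i).val) ?_
  · ext i
    have h1 := Nat.eq_zero_of_dvd_of_lt (he i) (ZMod.val_lt (e i))
    rw [ZMod.val_eq_zero] at h1
    simpa [e] using h1
  · intro τ hτ hτζ
    have hroot (i : I) : ∃ a : ZMod ℓ, τ (x i) = ζ ^ a.val * x i := by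
      have h1 : (τ (x i) / x i) ^ ℓ = 1 := by
        rw [div_pow, ← map_pow, hτ, div_self (pow_ne_zero _ (hx i))]
      obtain ⟨a, ha, h⟩ := hζ.eq_pow_of_pow_eq_one h1
      exact ⟨a, by rw [ZMod.val_natCast_of_lt ha, h, div_mul_cancel₀ _ (hx i)]⟩
    choose w hw using hroot
    have hwV : w ∈ V := ⟨τ, hτζ, hw⟩
    have h0 : f w = 0 := hVf hwV
    rw [hfe] at h0
    have hdvd : ℓ ∣ ∑ i, (w i).val * (e i).val := by
      rw [← ZMod.natCast_eq_zero_iff]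
      push_cast
      simpa using h0
    obtain ⟨b, hb⟩ := hdvd
    simp_rw [finprod_eq_prod_of_fintype, map_prod, map_pow, hw, mul_pow, Finset.prod_mul_distrib,
      ← pow_mul, Finset.prod_pow_eq_pow_sum, hb, pow_mul, hζ.pow_eq_one, one_pow, one_mul]

namespace IsRootLabelling

variable {F M : Type*} [Field F] [Field M] [Algebra F M]
variable {ℓ q : ℕ} {g : ℤ[X]} {c : Gal(M/F) →* Cyc q} {N : M → Cyc q}

/-- Lift a nontrivial element of `C_q` to `σ` and use `σ ^ ℓ!`. Since `σ ^ q` fixes every `x ^ ℓ`,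
its `ℓ!`-th power is trivial; `σ ^ ℓ!` fixes `ζ`; and its image is still nontrivial because `q ∤
ℓ!`. -/
theorem exists_section (H : IsRootLabelling ℓ q g c N) (hq : q.Prime) (hℓ : 0 < ℓ) (hℓq : ℓ < q)
    (hg : g.Monic) (hdeg : g.natDegree = q)
    (hM : ∀ σ : Gal(M/F), (∀ x : M, aeval (x ^ ℓ) g = 0 → σ x = x) → σ = 1)
    {ζ : M} (hζ : ζ ^ ℓ = 1) :
    ∃ s : Cyc q →* Gal(M/F), (∀ i, s i ζ = ζ) ∧ Function.Bijective fun i => c (s i) := by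
  have : NeZero q := ⟨hq.ne_zero⟩
  have : Fact q.Prime := ⟨hq⟩
  obtain ⟨t, ht⟩ : ∃ t : Cyc q, t ≠ 1 := exists_ne 1
  obtain ⟨σ, rfl⟩ := H.surjective t
  have hcq (t : Cyc q) : t ^ q = 1 := by
    apply Multiplicative.toAdd.injective
    simp
  have hσq : (σ ^ ℓ.factorial) ^ q = 1 := by
    apply hM
    intro x hx
    rw [pow_right_comm]
    apply pow_factorial_apply_eq_self hℓ
    exact H.apply_pow_eq hq hℓ hℓq hg hdeg (by rw [map_pow, hcq]) hx
  have hζσ : (σ ^ ℓ.factorial) ζ = ζ := pow_factorial_apply_eq_self hℓ σ (by rw [hζ, map_one])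
  let s : Cyc q →* Gal(M/F) :=
    { toFun i := (σ ^ ℓ.factorial) ^ (Multiplicative.toAdd i).val
      map_one' := by simp
      map_mul' i j := by rw [toAdd_mul, pow_zmod_val_add hσq] }
  refine ⟨s, fun i => ?_, ?_⟩
  · have hn (n : ℕ) : ((σ ^ ℓ.factorial) ^ n) ζ = ζ := by
      induction n with
      | zero => simp
      | succ n ih => rw [pow_succ, AlgEquiv.mul_apply, hζσ, ih]
    exact hn _
  · rw [Nat.bijective_iff_injective_and_card]
    refine ⟨(injective_iff_map_eq_one (c.comp s)).2 fun i hi => ?_, rfl⟩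
    have hi' : c σ ^ (ℓ.factorial * (Multiplicative.toAdd i).val) = 1 := by
      rw [pow_mul, ← map_pow, ← map_pow]
      exact hi
    by_contra hi1
    refine ht (Cyc.eq_one_of_pow_eq_one hq ?_ hi')
    rw [hq.dvd_mul, hq.dvd_factorial]
    rintro (h | h)
    · lia
    · have h0 := Nat.eq_zero_of_dvd_of_lt h (ZMod.val_lt _)
      rw [ZMod.val_eq_zero] at h0
      exact hi1 (Multiplicative.toAdd.injective h0)

theorem exists_labelling (H : IsRootLabelling ℓ q g c N) (hq : q.Prime) (hℓ : ℓ.Prime)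
    (hℓq : ℓ < q) (hg : g.Monic) (hdeg : g.natDegree = q) (hg0 : aeval (0 : M) g ≠ 0)
    (hM : ∀ σ : Gal(M/F), (∀ x : M, aeval (x ^ ℓ) g = 0 → σ x = x) → σ = 1)
    {ζ : M} (hζ : IsPrimitiveRoot ζ ℓ)
    (hrel : ∀ (s : Cyc q →* Gal(M/F)) (_ : Function.Bijective fun i => c (s i)) (x : M)
      (_ : aeval (x ^ ℓ) g = 0) (k : Cyc q → ℕ),
      (∀ τ : Gal(M/F), (∀ i, τ (s i x ^ ℓ) = s i x ^ ℓ) → τ ζ = ζ →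
      τ (∏ᶠ i, s i x ^ k i) = ∏ᶠ i, s i x ^ k i) → ∀ i, ℓ ∣ k i) :
    ∃ E : Cyc ℓ × Cyc q → M, Function.Injective E ∧
      (∀ x, x ∈ Set.range E ↔ aeval (x ^ ℓ) g = 0) ∧
      ∀ (v : Cyc q → Cyc ℓ) (j : Cyc q), ∃ τ : Gal(M/F), ∀ a i,
        τ (E (a, i)) = E (v (j * i) * a, j * i) := by
  have : NeZero q := ⟨hq.ne_zero⟩
  have : NeZero ℓ := ⟨hℓ.ne_zero⟩
  obtain ⟨s, hsζ, hs⟩ := H.exists_section hq hℓ.pos hℓq hg hdeg hM hζ.pow_eq_one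
  obtain ⟨x, hx, -⟩ := H.exists_label_eq 1
  have hne {x : M} (hx : aeval (x ^ ℓ) g = 0) : x ≠ 0 := by
    rintro rfl
    rw [zero_pow hℓ.ne_zero] at hx
    exact hg0 hx
  have hsx (i : Cyc q) : aeval (s i x ^ ℓ) g = 0 := aeval_apply_pow_eq_zero (s i) hx
  have hkum := exists_gal_apply_eq_pow_mul (F := F) hℓ hζ (fun i => hne (hsx i)) (hrel s hs x hx)
  -- The roots of `f` are the products `ζ ^ a * s i x`: `s` permutes the blocks, and the Kummer
  -- automorphisms rotate each block independently.
  let E : Cyc ℓ × Cyc q → M := fun w => ζ ^ (Multiplicative.toAdd w.1).val * s w.2 x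
  have hEpow (w : Cyc ℓ × Cyc q) : E w ^ ℓ = s w.2 x ^ ℓ := by
    rw [mul_pow, pow_right_comm, hζ.pow_eq_one, one_pow, one_mul]
  have hNE (w : Cyc ℓ × Cyc q) : N (E w) = c (s w.2) * N x := by
    rw [← H.label_apply _ _ hx, ← H.pow_eq_pow_iff hq hℓ.pos hℓq hg hdeg _ (hsx _), hEpow]
    rw [hEpow, hsx]
  refine ⟨E, ?_, ?_, ?_⟩
  · rintro ⟨a, i⟩ ⟨b, j⟩ h
    have hij : i = j := by
      have := congrArg N h
      rw [hNE, hNE, mul_left_inj] at this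
      exact hs.1 this
    subst hij
    have h2 := mul_right_cancel₀ (hne (hsx i)) h
    have h3 := hζ.pow_inj (ZMod.val_lt _) (ZMod.val_lt _) h2
    exact congrArg (·, i) (Multiplicative.toAdd.injective (ZMod.val_injective _ h3))
  · intro z
    constructor
    · rintro ⟨w, rfl⟩
      rw [hEpow, hsx]
    · intro hz
      obtain ⟨i, hi⟩ := hs.2 (N z * (N x)⁻¹)
      have h1 : z ^ ℓ = s i x ^ ℓ := by
        rw [H.pow_eq_pow_iff hq hℓ.pos hℓq hg hdeg hz (hsx i), H.label_apply _ _ hx]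
        have hi' : c (s i) = N z * (N x)⁻¹ := hi
        rw [hi', inv_mul_cancel_right]
      obtain ⟨a, ha, h⟩ := hζ.eq_pow_of_pow_eq_one (ξ := z / s i x)
        (by rw [div_pow, h1, div_self (pow_ne_zero _ (hne (hsx i)))])
      refine ⟨(Multiplicative.ofAdd (a : ZMod ℓ), i), ?_⟩
      change ζ ^ (a : ZMod ℓ).val * s i x = z
      rw [ZMod.val_natCast_of_lt ha, h, div_mul_cancel₀ _ (hne (hsx i))]
  · intro v j
    obtain ⟨τ, hτζ, hτ⟩ := hkum fun i => Multiplicative.toAdd (v i)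
    refine ⟨τ * s j, fun a i => ?_⟩
    change (τ * s j) (ζ ^ _ * s i x) = ζ ^ (Multiplicative.toAdd (v (j * i) * a)).val * s (j * i) x
    rw [AlgEquiv.mul_apply, map_mul, map_pow, hsζ, ← AlgEquiv.mul_apply, ← map_mul, map_mul τ,
      map_pow, hτζ, hτ, toAdd_mul, pow_zmod_val_add hζ.pow_eq_one]
    ring

end IsRootLabelling

namespace IsRootLabelling

variable {F M : Type*} [Field F] [Field M] [CharZero M] [Algebra F M] [FiniteDimensional F M]
  [IsGalois F M] {ℓ q : ℕ} {g : ℤ[X]} {c : Gal(M/F) →* Cyc q} {N : M → Cyc q}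

/-- A fixed monomial in the `s i x` has its `ℓ`-th power in the fixed field of `c.ker`, where by
descent it is already an `ℓ`-th power. The `s i` restrict bijectively to the Galois group of that
field, so `hpow` applies. -/
theorem dvd_of_prod_fixed (H : IsRootLabelling ℓ q g c N) (hq : q.Prime) (hℓ : ℓ.Prime)
    (hℓq : ℓ < q) {ζ : M} (hζ : IsPrimitiveRoot ζ ℓ)
    (s : Cyc q →* Gal(M/F)) (hs : Function.Bijective fun i => c (s i)) (x : M)
    (hx : aeval (x ^ ℓ) g = 0) (y : fixedField c.ker) (hy : (y : M) = x ^ ℓ)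
    (hpow : ∀ (k : Gal(fixedField c.ker/F) → ℕ) (u : fixedField c.ker),
      ∏ ρ : Gal(fixedField c.ker/F), ρ y ^ k ρ = u ^ ℓ → ∀ ρ, ℓ ∣ k ρ) (k : Cyc q → ℕ)
    (hfix : ∀ τ : Gal(M/F), (∀ i, τ (s i x ^ ℓ) = s i x ^ ℓ) → τ ζ = ζ →
      τ (∏ᶠ i, s i x ^ k i) = ∏ᶠ i, s i x ^ k i) (i : Cyc q) : ℓ ∣ k i := by
  have : NeZero q := ⟨hq.ne_zero⟩
  have := IsGalois.of_fixedField_normal_subgroup c.ker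
  let r : Cyc q → Gal(fixedField c.ker/F) := fun i =>
    AlgEquiv.restrictNormalHom (fixedField c.ker) (s i)
  have hr (i : Cyc q) : ((r i y : fixedField c.ker) : M) = s i x ^ ℓ := by
    rw [← map_pow, ← hy]
    exact (s i).restrictNormal_commutes (fixedField c.ker) y
  have hrbij : Function.Bijective r := by
    rw [Nat.bijective_iff_injective_and_card]
    constructor
    · intro i j hij
      apply hs.1
      refine H.map_eq_of_apply_eq hq hℓ.pos hℓq hx ?_
      rw [map_pow, map_pow, ← hr, ← hr, hij]
    · rw [H.card_gal_fixedField_ker, Nat.card_congr Multiplicative.toAdd, Nat.card_zmod]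
  let e := Equiv.ofBijective r hrbij
  have hz : (∏ᶠ i, s i x ^ k i) ^ ℓ = algebraMap (fixedField c.ker) M (∏ i, r i y ^ k i) := by
    rw [finprod_eq_prod_of_fintype, ← Finset.prod_pow, map_prod]
    refine Finset.prod_congr rfl fun i _ => ?_
    rw [map_pow, IntermediateField.algebraMap_apply, hr, pow_right_comm]
  obtain ⟨u, hu⟩ := exists_pow_eq_of_fixed hℓ hζ hz fun τ hτ => by
    refine hfix (τ.restrictScalars F) (fun i => ?_) hτ
    rw [← hr]
    exact τ.commutes (r i y)
  have := hpow (fun ρ => k (e.symm ρ)) u (by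
    rw [hu, ← e.prod_comp]
    refine Finset.prod_congr rfl fun i _ => ?_
    rw [e.symm_apply_apply]
    rfl) (e i)
  rwa [e.symm_apply_apply] at this

end IsRootLabelling

section Rational

variable {M : Type*} [Field M] [CharZero M] [inst : Algebra ℚ M] [FiniteDimensional ℚ M]
  [IsGalois ℚ M] {ℓ q : ℕ} {g : ℤ[X]} {c : Gal(M/ℚ) →* Cyc q} {N : M → Cyc q}

namespace IsRootLabelling

theorem exists_labelling_of_not_dvd (H : IsRootLabelling ℓ q g c N) (hq : q.Prime) (hℓ : ℓ.Prime)
    (hℓq : ℓ < q) (hg : g.Monic) (hdeg : g.natDegree = q) (hg0 : aeval (0 : M) g ≠ 0)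
    (hM : ∀ σ : Gal(M/ℚ), (∀ x : M, aeval (x ^ ℓ) g = 0 → σ x = x) → σ = 1)
    {ζ : M} (hζ : IsPrimitiveRoot ζ ℓ) {p : ℕ} (hp : p.Prime) (h0 : (p : ℤ) ∣ g.coeff 0)
    (h00 : ¬ (p : ℤ) * p ∣ g.coeff 0) (h1 : ¬ (p : ℤ) ∣ g.coeff 1) :
    ∃ E : Cyc ℓ × Cyc q → M, Function.Injective E ∧
      (∀ x, x ∈ Set.range E ↔ aeval (x ^ ℓ) g = 0) ∧
      ∀ (v : Cyc q → Cyc ℓ) (j : Cyc q), ∃ τ : Gal(M/ℚ), ∀ a i,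
        τ (E (a, i)) = E (v (j * i) * a, j * i) := by
  have hgal := IsGalois.of_fixedField_normal_subgroup c.ker
  refine H.exists_labelling hq hℓ hℓq hg hdeg hg0 hM hζ fun s hs x hx k hfix i => ?_
  have hmem := H.pow_mem_fixedField hq hℓ.pos hℓq hg hdeg hx
  refine H.dvd_of_prod_fixed hq hℓ hℓq hζ s hs x hx ⟨x ^ ℓ, hmem⟩ rfl ?_ k hfix i
  refine dvd_of_prod_galois_pow_eq_pow (inst := IntermediateField.algebra' _) hq hℓ hℓq.ne
    H.card_gal_fixedField_ker hg hdeg ?_ (H.injective_gal_fixedField hq hℓ.pos hℓq hx rfl)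
    hp h0 h00 h1
  apply (algebraMap (fixedField c.ker) M).injective
  rw [← aeval_algebraMap_apply, map_zero]
  exact hx

omit [CharZero M] in
theorem dvd_coeff_and_modEq (H : IsRootLabelling ℓ q g c N) (hq : q.Prime) (hℓ : ℓ.Prime)
    (hℓq : ℓ < q) (hg : g.Monic) (hdeg : g.natDegree = q)
    {p : ℕ} (hp : p.Prime) (h0 : (p : ℤ) ∣ g.coeff 0)
    (h00 : ¬ (p : ℤ) * p ∣ g.coeff 0) (h1 : (p : ℤ) ∣ g.coeff 1) :
    (∀ i < q, (p : ℤ) ∣ g.coeff i) ∧ (p = q ∨ p ≡ 1 [MOD q]) := by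
  have hgal := IsGalois.of_fixedField_normal_subgroup c.ker
  obtain ⟨x, hx, -⟩ := H.exists_label_eq 1
  have hmem := H.pow_mem_fixedField hq hℓ.pos hℓq hg hdeg hx
  refine dvd_coeff_and_modEq_of_isGalois (inst := IntermediateField.algebra' _) hq
    H.card_gal_fixedField_ker hg hdeg (y := ⟨x ^ ℓ, hmem⟩) ?_
    (H.injective_gal_fixedField hq hℓ.pos hℓq hx rfl) hp h0 h00 h1
  apply (algebraMap (fixedField c.ker) M).injective
  rw [← aeval_algebraMap_apply, map_zero]
  exact hx

end IsRootLabelling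

end Rational

/-! ### From permutation groups to labellings and back -/

section GaloisGroup

variable {F : Type*} [Field F] {ℓ q : ℕ} {g : ℤ[X]}

theorem mem_rootSet_map_comp_X_pow {M : Type*} [Field M] [Algebra F M] {f : F[X]}
    (hfg : f = (g.comp (X ^ ℓ)).map (algebraMap ℤ F)) (hf : f ≠ 0) {x : M} :
    x ∈ f.rootSet M ↔ aeval (x ^ ℓ) g = 0 := by
  rw [mem_rootSet, and_iff_right hf, hfg, aeval_map_algebraMap, aeval_comp]
  simp

theorem toPermHom_gal_apply (f : F[X]) (σ : f.Gal) (x : f.rootSet f.SplittingField) :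
    ((MulAction.toPermHom f.Gal (f.rootSet f.SplittingField) σ x :
      f.rootSet f.SplittingField) : f.SplittingField) = σ x := rfl

theorem isGalois_splittingField {f : F[X]} (hf : f.Separable) : IsGalois F f.SplittingField :=
  IsGalois.of_separable_splitting_field hf

theorem finiteDimensional_splittingField (f : F[X]) : FiniteDimensional F f.SplittingField :=
  inferInstance

theorem exists_isRootLabelling (hℓ : 0 < ℓ) {f : F[X]}
    (hfg : f = (g.comp (X ^ ℓ)).map (algebraMap ℤ F)) (hirr : Irreducible f)
    (hsub : IsPermSubgroup (MulAction.toPermHom f.Gal (f.rootSet f.SplittingField)).range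
      (symWreathCyc ℓ q)) :
    ∃ (c : f.Gal →* Cyc q) (N : f.SplittingField → Cyc q), IsRootLabelling ℓ q g c N := by
  classical
  obtain ⟨e, he⟩ := hsub
  have hroot (x : f.SplittingField) := mem_rootSet_map_comp_X_pow hfg hirr.ne_zero (x := x)
  -- The value 1 off the roots is arbitrary: a labelling is only constrained on roots.
  let N : f.SplittingField → Cyc q := fun x =>
    if h : x ∈ f.rootSet f.SplittingField then (e ⟨x, h⟩).2 else 1
  have hN (x : f.rootSet f.SplittingField) : N x = (e x).2 := dif_pos x.2
  have hc (σ : f.Gal) : ∃ j : Cyc q, ∀ x : f.rootSet f.SplittingField, N (σ x) = j * N x := by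
    obtain ⟨w, hw⟩ := he _ ⟨σ, rfl⟩
    refine ⟨w.right, fun x => ?_⟩
    have h1 := congrArg (fun π => (π (e x)).2) hw
    have h2 : N (σ x) = (e (MulAction.toPermHom f.Gal (f.rootSet f.SplittingField) σ x)).2 := by
      rw [← hN, toPermHom_gal_apply]
    have h3 : (e (MulAction.toPermHom f.Gal (f.rootSet f.SplittingField) σ x)).2 =
        w.right * (e x).2 := by
      simp only [Equiv.permCongr_apply, Equiv.symm_apply_apply] at h1
      exact h1.symm
    rw [h2, h3, hN]
  choose c hc using hc
  let x₀ : f.rootSet f.SplittingField := e.symm (⟨0, hℓ⟩, 1)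
  let c' : f.Gal →* Cyc q := MonoidHom.mk' c fun σ τ => by
    apply mul_right_cancel (b := N x₀)
    rw [← hc, mul_assoc, ← hc]
    exact hc σ (MulAction.toPermHom f.Gal (f.rootSet f.SplittingField) τ x₀)
  refine ⟨c', N, ⟨fun x x' hx hx' => ?_, fun σ x hx => hc σ ⟨x, (hroot x).2 hx⟩, fun j => ?_⟩⟩
  · have h1 := minpoly.eq_of_irreducible hirr (mem_rootSet.1 ((hroot x).2 hx)).2
    have h2 := minpoly.eq_of_irreducible hirr (mem_rootSet.1 ((hroot x').2 hx')).2
    obtain ⟨σ, hσ⟩ := (Normal.minpoly_eq_iff_mem_orbit f.SplittingField).mp (h2.symm.trans h1)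
    exact ⟨σ, hσ⟩
  · refine ⟨e.symm (⟨0, hℓ⟩, j), (hroot _).1 (e.symm _).2, ?_⟩
    rw [hN, Equiv.apply_symm_apply]

/-- `X ^ ℓ - x ^ ℓ` divides `f`, so it splits; the ratio of two distinct roots has order `ℓ`. -/
theorem exists_isPrimitiveRoot_of_splits {M : Type*} [Field M] [CharZero M] [Algebra F M]
    (hℓ : ℓ.Prime) {f : F[X]} (hfg : f = (g.comp (X ^ ℓ)).map (algebraMap ℤ F)) (hf : f ≠ 0)
    (hs : (f.map (algebraMap F M)).Splits) {x : M} (hx : aeval (x ^ ℓ) g = 0) (hx0 : x ≠ 0) :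
    ∃ ζ : M, IsPrimitiveRoot ζ ℓ := by
  classical
  have hdvd : X ^ ℓ - C (x ^ ℓ) ∣ f.map (algebraMap F M) := by
    have h1 : X - C (x ^ ℓ) ∣ g.map (algebraMap ℤ M) := by
      rw [dvd_iff_isRoot, IsRoot.def, eval_map_algebraMap, hx]
    have h2 := map_dvd (compRingHom (X ^ ℓ)) h1
    have h3 : f.map (algebraMap F M) = (g.map (algebraMap ℤ M)).comp (X ^ ℓ) := by
      rw [hfg, Polynomial.map_map, Polynomial.map_comp, Polynomial.map_pow, map_X,
        RingHom.ext_int ((algebraMap F M).comp (algebraMap ℤ F)) (algebraMap ℤ M)]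
    rw [h3]
    simpa using h2
  have hsplit := hs.of_dvd (map_ne_zero hf) hdvd
  have hsep : (X ^ ℓ - C (x ^ ℓ) : M[X]).Separable :=
    separable_X_pow_sub_C _ (by exact_mod_cast hℓ.ne_zero) (pow_ne_zero _ hx0)
  have hcard := card_rootSet_eq_natDegree (K := M) hsep (by simpa using hsplit)
  rw [natDegree_X_pow_sub_C] at hcard
  obtain ⟨⟨x', hx'⟩, hne⟩ := Fintype.exists_ne_of_one_lt_card (by rw [hcard]; exact hℓ.one_lt)
    (⟨x, by rw [mem_rootSet]; exact ⟨X_pow_sub_C_ne_zero hℓ.pos _, by simp⟩⟩ :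
      (X ^ ℓ - C (x ^ ℓ) : M[X]).rootSet M)
  have hpow : x' ^ ℓ = x ^ ℓ := by
    have := (mem_rootSet.1 hx').2
    simpa [sub_eq_zero] using this
  refine ⟨x' / x, ?_⟩
  have : Fact ℓ.Prime := ⟨hℓ⟩
  rw [← orderOf_eq_prime (x := x' / x) (p := ℓ)]
  · exact IsPrimitiveRoot.orderOf _
  · rw [div_pow, hpow, div_self (pow_ne_zero _ hx0)]
  · rw [Ne, div_eq_one_iff_eq hx0]
    exact fun h => hne (Subtype.ext h)

theorem isPermSubgroup_cycWreathCyc {f : F[X]}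
    (hfg : f = (g.comp (X ^ ℓ)).map (algebraMap ℤ F)) (hf : f ≠ 0)
    {E : Cyc ℓ × Cyc q → f.SplittingField} (hE : Function.Injective E)
    (hrange : ∀ x, x ∈ Set.range E ↔ aeval (x ^ ℓ) g = 0)
    (hgal : ∀ (v : Cyc q → Cyc ℓ) (j : Cyc q), ∃ τ : f.Gal, ∀ a i,
      τ (E (a, i)) = E (v (j * i) * a, j * i)) :
    IsPermSubgroup (cycWreathCyc ℓ q)
      (MulAction.toPermHom f.Gal (f.rootSet f.SplittingField)).range := by
  have hroot (x : f.SplittingField) := mem_rootSet_map_comp_X_pow hfg hf (x := x)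
  have hmem (w : Cyc ℓ × Cyc q) : E w ∈ f.rootSet f.SplittingField :=
    (hroot _).2 ((hrange _).1 ⟨w, rfl⟩)
  let e : Cyc ℓ × Cyc q ≃ f.rootSet f.SplittingField :=
    Equiv.ofBijective (fun w => ⟨E w, hmem w⟩)
      ⟨fun w w' h => hE (congrArg Subtype.val h), fun x => by
        obtain ⟨w, hw⟩ := (hrange x).2 ((hroot _).1 x.2)
        exact ⟨w, Subtype.ext hw⟩⟩
  refine ⟨e, ?_⟩
  rintro _ ⟨w, rfl⟩
  obtain ⟨τ, hτ⟩ := hgal w.left w.right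
  refine ⟨τ, Equiv.ext fun x => ?_⟩
  obtain ⟨⟨a, i⟩, rfl⟩ := e.surjective x
  rw [Equiv.permCongr_apply, Equiv.symm_apply_apply]
  apply Subtype.ext
  rw [toPermHom_gal_apply]
  exact hτ a i

end GaloisGroup

/-! ### The Eisenstein condition and the conclusion -/

theorem isEisensteinAt_comp_X_pow {g : ℤ[X]} {ℓ q p : ℕ} (hp : p.Prime)
    (hf : (g.comp (X ^ ℓ)).Monic) (hℓ : 0 < ℓ) (hdeg : g.natDegree = q)
    (h : ∀ i < q, (p : ℤ) ∣ g.coeff i) (h00 : ¬ (p : ℤ) * p ∣ g.coeff 0) :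
    (g.comp (X ^ ℓ)).IsEisensteinAt (Ideal.span {(p : ℤ)}) := by
  have hpp := Nat.prime_iff_prime_int.1 hp
  refine ⟨?_, fun {n} hn => ?_, ?_⟩
  · rw [hf.leadingCoeff, Ideal.mem_span_singleton]
    exact hpp.not_dvd_one
  · rw [natDegree_comp, natDegree_X_pow, hdeg] at hn
    rw [Ideal.mem_span_singleton, ← expand_eq_comp_X_pow, coeff_expand hℓ]
    split_ifs with hd
    · exact h _ (Nat.div_lt_of_lt_mul (by rwa [mul_comm]))
    · exact dvd_zero _
  · rw [Ideal.span_singleton_pow, Ideal.mem_span_singleton, ← expand_eq_comp_X_pow,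
      coeff_expand hℓ, if_pos (dvd_zero _), Nat.zero_div, pow_two]
    exact h00

theorem dvd_coeff_and_modEq_of_isPermSubgroup {ℓ q : ℕ} (hℓ : ℓ.Prime) (hq : q.Prime) (hℓq : ℓ < q)
    {g : ℤ[X]} (hg : g.Monic) (hdeg : g.natDegree = q) (hf : (g.comp (X ^ ℓ)).Monic)
    (hirr : Irreducible (g.comp (X ^ ℓ)))
    (hsub : IsPermSubgroup (galPermGroup (g.comp (X ^ ℓ))) (symWreathCyc ℓ q))
    (hnot : ¬ IsPermSubgroup (cycWreathCyc ℓ q) (galPermGroup (g.comp (X ^ ℓ))))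
    {p : ℕ} (hp : p.Prime) (h0 : (p : ℤ) ∣ g.coeff 0) (h00 : ¬ (p : ℤ) * p ∣ g.coeff 0) :
    (∀ i < q, (p : ℤ) ∣ g.coeff i) ∧ (p = q ∨ p ≡ 1 [MOD q]) := by
  have hirrQ := (hf.irreducible_iff_irreducible_map_fraction_map (K := ℚ)).1 hirr
  obtain ⟨c, N, H⟩ := exists_isRootLabelling hℓ.pos rfl hirrQ hsub
  have hgal := isGalois_splittingField hirrQ.separable
  have hfin := finiteDimensional_splittingField ((g.comp (X ^ ℓ)).map (algebraMap ℤ ℚ))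
  -- The case `p ∤ a_1` is the one excluded by `hnot`.
  by_cases h1 : (p : ℤ) ∣ g.coeff 1
  · exact H.dvd_coeff_and_modEq hq hℓ hℓq hg hdeg hp h0 h00 h1
  · refine absurd ?_ hnot
    have hg0 : aeval (0 : ((g.comp (X ^ ℓ)).map (algebraMap ℤ ℚ)).SplittingField) g ≠ 0 := by
      rw [← coeff_zero_eq_aeval_zero']
      intro h
      have : g.coeff 0 = 0 := by simpa using h
      exact h00 (this ▸ dvd_zero _)
    obtain ⟨x, hx, -⟩ := H.exists_label_eq 1
    have hx0 : x ≠ 0 := by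
      rintro rfl
      rw [zero_pow hℓ.ne_zero] at hx
      exact hg0 hx
    obtain ⟨ζ, hζ⟩ := exists_isPrimitiveRoot_of_splits (F := ℚ) hℓ rfl hirrQ.ne_zero
      (SplittingField.splits _) hx hx0
    obtain ⟨E, hE, hrange, hE'⟩ := H.exists_labelling_of_not_dvd hq hℓ hℓq hg hdeg hg0
      (fun σ hσ => Polynomial.Gal.ext (F := ℚ) _ fun x hx => hσ x
        ((mem_rootSet_map_comp_X_pow rfl hirrQ.ne_zero).1 hx)) hζ hp h0 h00 h1
    exact isPermSubgroup_cycWreathCyc rfl hirrQ.ne_zero hE hrange hE'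

theorem lemma3p1 (ℓ q : ℕ) (hℓ : ℓ.Prime) (hq : q.Prime) (hℓq : ℓ < q)
    (g : ℤ[X]) (hg : g.Monic) (hdeg : g.natDegree = q)
    (hf : IsMonogenicPoly (g.comp (X ^ ℓ)))
    (hsub : IsPermSubgroup (galPermGroup (g.comp (X ^ ℓ))) (symWreathCyc ℓ q))
    (hnot : ¬ IsPermSubgroup (cycWreathCyc ℓ q) (galPermGroup (g.comp (X ^ ℓ)))) :
    (∀ p : ℕ, p.Prime → (p : ℤ) ∣ g.coeff 0 →
      (g.comp (X ^ ℓ)).IsEisensteinAt (Ideal.span {(p : ℤ)})) ∧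
    Squarefree (g.coeff 0) ∧
    (∀ i < q, g.coeff 0 ∣ g.coeff i) ∧
    (∀ p : ℕ, p.Prime → (p : ℤ) ∣ g.coeff 0 → p = q ∨ p ≡ 1 [MOD q]) := by
  have hsq := squarefree_coeff_zero_of_isMonogenicPoly hℓ.two_le hf
  have h00 (p : ℕ) (hp : p.Prime) : ¬ (p : ℤ) * p ∣ g.coeff 0 := fun h =>
    (Nat.prime_iff_prime_int.1 hp).not_isUnit (hsq _ h)
  have key (p : ℕ) (hp : p.Prime) (h0 : (p : ℤ) ∣ g.coeff 0) :=
    dvd_coeff_and_modEq_of_isPermSubgroup hℓ hq hℓq hg hdeg hf.1 hf.2.1 hsub hnot hp h0 (h00 p hp)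
  refine ⟨fun p hp h0 => isEisensteinAt_comp_X_pow hp hf.1 hℓ.pos hdeg (key p hp h0).1 (h00 p hp),
    hsq, fun i hi => ?_, fun p hp h0 => (key p hp h0).2⟩
  -- A squarefree `a_0` is, up to sign, the product of its prime divisors, so divisibility is
  -- checked prime by prime.
  rw [← Int.natAbs_dvd_natAbs, ← Nat.prod_primeFactors_of_squarefree (Int.squarefree_natAbs.2 hsq)]
  refine Finset.prod_primes_dvd _ (fun p hp => (Nat.prime_of_mem_primeFactors hp).prime) fun p hp => ?_
  rw [← Int.natCast_dvd]
  exact (key p (Nat.prime_of_mem_primeFactors hp)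
    (Int.natCast_dvd.2 (Nat.dvd_of_mem_primeFactors hp))).1 i hi
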